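/- A deterministic shared object type $T$ has a set of states, a set of operations (an operation includes its arguments), and a sequential specification that gives a unique next state and a unique response for each operation applied in each state. It is readable if it has an operation that returns the entire state of the object without altering it. Let $q_0$ be a state, $op_1,\dots,op_n$ (not necessarily distinct) operations, and $A,B$ a partition of $\{1,\dots,n\}$ into two non-empty teams. For $X\in\{A,B\}$, consider the sequences $i_1,\dots,i_\alpha$ ($\alpha\ge 1$) of distinct indices with $i_1\in X$, and perform $op_{i_1},\dots,op_{i_\alpha}$ in this order on an object of type $T$ initially in state $q_0$. Let $Q_X$ be the set of all states in which the object can end up in this way, and for each $j$ let $R_{X,j}$ be the set of pairs $(r,q)$ such that, for some such sequence that includes $j$, $op_j$ returns $r$ and the object ends up in state $q$. The type $T$ is $n$-discerning if $q_0,A,B,op_1,\dots,op_n$ can be chosen so that $R_{A,j}\cap R_{B,j}=\emptyset$ for all $j$. It is $n$-recording if they can be chosen so that (1) $Q_A\cap Q_B=\emptyset$, (2) $q_0\notin Q_A$ or $|B|=1$, and (3) $q_0\notin Q_B$ or $|A|=1$. Consider asynchronous processes that communicate by atomic operations on arbitrarily (possibly infinitely) many shared objects of type $T$ and read/write registers,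 with initial states chosen by the algorithm. In the consensus problem each process has an input; no two outputs may be different (agreement), each output must be the input of some process (validity), and each process outputs a value after finitely many of its own steps, however the steps of the processes are interleaved (wait-freedom). In recoverable consensus, each process may moreover crash at any time, independently of the others and any number of times: its local state is reset, so that it starts a new run of its algorithm from the beginning with the same input, while the shared memory is unaffected. Agreement and validity then concern all outputs of all runs, and each run must either crash or output a value after finitely many of the process's own steps. Let $cons(T)$ (respectively $rcons(T)$) be the maximum number of processes that can solve consensus (respectively recoverable consensus) using objects of type $T$ and registers, or $\infty$ if there is no maximum. Proposition. If a deterministic, readable type $T$ is 3-discerning, then it is 2-recording. Moreover, if $T$ is a deterministic, readable type with $cons(T)=3$, then $2\le rcons(T)\le 3$. -/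

import Mathlib

universe u

/-- A deterministic shared object type, given by its sequential specification: the states, the
operations (names together with arguments), the responses, and, for every state and operation,
the unique next state and the unique response. -/
structure ObjType where
  State : Type u
  Op : Type u
  Resp : Type u
  next : State → Op → State
  resp : State → Op → Resp

namespace ObjType

/-- The type has a read operation, which never changes the state and whose response determines
the entire state. -/
def Readable (T : ObjType.{u}) : Prop :=
  ∃ rd : T.Op, (∀ q, T.next q rd = q) ∧ Function.Injective fun q => T.resp q rd

variable (T : ObjType.{u}) {n : ℕ}

/-- The state reached from `q` when the operations `op i`, for `i` in the list `l`, are performed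
in the order of the list. -/
def nextList (op : Fin n → T.Op) (q : T.State) (l : List (Fin n)) : T.State :=
  l.foldl (fun q i => T.next q (op i)) q

/-- The set `R_{X,j}` of pairs `(r, q)` for which there is a sequence of distinct indices that
starts in `X` and contains `j` (it is written as `l₁`, then `j`, then `l₂`) such that performing
the corresponding operations from `q₀` makes `op j` return `r` and leaves the object in `q`. -/
def discernSet (q₀ : T.State) (op : Fin n → T.Op) (X : Finset (Fin n)) (j : Fin n) :
    Set (T.Resp × T.State) :=
  {p | ∃ l₁ l₂ : List (Fin n), (l₁ ++ j :: l₂).Nodup ∧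
    (∃ i ∈ X, (l₁ ++ j :: l₂).head? = some i) ∧
    p.1 = T.resp (T.nextList op q₀ l₁) (op j) ∧
    p.2 = T.nextList op q₀ (l₁ ++ j :: l₂)}

/-- The set `Q_X` of states that can be reached from `q₀` by a sequence of operations with
distinct indices, the first of which is in `X`. -/
def recordSet (q₀ : T.State) (op : Fin n → T.Op) (X : Finset (Fin n)) : Set T.State :=
  {q | ∃ l : List (Fin n), l.Nodup ∧ (∃ i ∈ X, l.head? = some i) ∧ q = T.nextList op q₀ l}

/-- `A` and `B` are two non-empty teams that partition the `n` participants. -/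
def IsTeams (A B : Finset (Fin n)) : Prop :=
  A.Nonempty ∧ B.Nonempty ∧ Disjoint A B ∧ A ∪ B = Finset.univ

/-- The property of being `n`-discerning. -/
def Discerning (n : ℕ) : Prop :=
  ∃ (q₀ : T.State) (A B : Finset (Fin n)) (op : Fin n → T.Op), IsTeams A B ∧
    ∀ j, T.discernSet q₀ op A j ∩ T.discernSet q₀ op B j = ∅

/-- The property of being `n`-recording. -/
def Recording (n : ℕ) : Prop :=
  ∃ (q₀ : T.State) (A B : Finset (Fin n)) (op : Fin n → T.Op), IsTeams A B ∧
    T.recordSet q₀ op A ∩ T.recordSet q₀ op B = ∅ ∧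
    (q₀ ∉ T.recordSet q₀ op A ∨ B.card = 1) ∧
    (q₀ ∉ T.recordSet q₀ op B ∨ A.card = 1)

end ObjType

/-- What an algorithm does in a given local state: it has returned an output (and halts), or its
next step is one atomic access to an object of type `T` or to a read/write register, after which
the local state depends on the response. -/
inductive Instr (T : ObjType.{u}) (Obj Reg RegVal Local V : Type u) : Type u where
  | output (v : V)
  | access (x : Obj) (o : T.Op) (k : T.Resp → Local)
  | read (r : Reg) (k : RegVal → Local)
  | write (r : Reg) (a : RegVal) (k : Local)

/-- An algorithm for `n` asynchronous sequential participants with inputs and outputs in `V`,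
which communicate through arbitrarily many objects of type `T` and arbitrarily many registers,
all with initial values chosen by the algorithm. -/
structure Algorithm (T : ObjType.{u}) (n : ℕ) (V : Type u) where
  Obj : Type u
  Reg : Type u
  RegVal : Type u
  Local : Type u
  objInit : Obj → T.State
  regInit : Reg → RegVal
  /-- The local state at the beginning of every run, for a given input. -/
  start : Fin n → V → Local
  /-- The code of each participant. -/
  code : Fin n → Local → Instr T Obj Reg RegVal Local V

/-- The events of an execution: one participant takes its next step, or it crashes (and will
restart its code from the beginning). -/
inductive Event (n : ℕ) where
  | step (p : Fin n)
  | crash (p : Fin n)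

namespace Algorithm

variable {T : ObjType.{u}} {n : ℕ} {V : Type u}

/-- A configuration: the contents of the shared memory and all local states. -/
@[ext] structure Config (alg : Algorithm T n V) where
  obj : alg.Obj → T.State
  reg : alg.Reg → alg.RegVal
  loc : Fin n → alg.Local

variable (alg : Algorithm T n V)

/-- The initial configuration for a given assignment of inputs. -/
def initConfig (inp : Fin n → V) : alg.Config where
  obj := alg.objInit
  reg := alg.regInit
  loc := fun p => alg.start p (inp p)

open Classical in
/-- The configuration after one event. A step of a participant that has already returned an output
has no effect. A crash resets the local state and leaves the shared memory unchanged. -/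
noncomputable def apply (inp : Fin n → V) (c : alg.Config) : Event n → alg.Config
  | .step p =>
    match alg.code p (c.loc p) with
    | .output _ => c
    | .access x o k =>
      { c with
        obj := Function.update c.obj x (T.next (c.obj x) o)
        loc := Function.update c.loc p (k (T.resp (c.obj x) o)) }
    | .read r k => { c with loc := Function.update c.loc p (k (c.reg r)) }
    | .write r a k =>
      { c with
        reg := Function.update c.reg r a
        loc := Function.update c.loc p k }
  | .crash p => { c with loc := Function.update c.loc p (alg.start p (inp p)) }

/-- The configuration at the end of a finite execution that starts in configuration `c`. -/
noncomputable def exec (inp : Fin n → V) (c : alg.Config) (es : List (Event n)) : alg.Config :=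
  es.foldl (alg.apply inp) c

/-- In configuration `c`, the current run of `p` has returned the output `v`. -/
def Outputs (c : alg.Config) (p : Fin n) (v : V) : Prop :=
  alg.code p (c.loc p) = .output v

/-- Agreement, in the executions with events in `E`: no two values that are output in the same
execution are different. The two outputs may be due to different participants or to different runs
of the same participant, and `es ++ es'` extends `es`, so they may occur at different times. -/
def Agreement (E : Set (Event n)) : Prop :=
  ∀ (inp : Fin n → V) (es es' : List (Event n)), (∀ e ∈ es ++ es', e ∈ E) →
    ∀ (p p' : Fin n) (v v' : V),
      alg.Outputs (alg.exec inp (alg.initConfig inp) es) p v →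
      alg.Outputs (alg.exec inp (alg.initConfig inp) (es ++ es')) p' v' → v = v'

/-- Validity, in the executions with events in `E`: each output is the input of some
participant. -/
def Validity (E : Set (Event n)) : Prop :=
  ∀ (inp : Fin n → V) (es : List (Event n)), (∀ e ∈ es, e ∈ E) →
    ∀ (p : Fin n) (v : V),
      alg.Outputs (alg.exec inp (alg.initConfig inp) es) p v → ∃ p', inp p' = v

/-- (Recoverable) wait-freedom, in the executions with events in `E`: in every infinite execution,
a participant that takes infinitely many steps and does not crash from time `t` on has returned an
output at some time `s ≥ t`. In other words, every run of the code crashes or returns an output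
after finitely many steps of its own, no matter how the others are scheduled. -/
def WaitFree (E : Set (Event n)) : Prop :=
  ∀ (inp : Fin n → V) (e : ℕ → Event n), (∀ s, e s ∈ E) →
    ∀ (p : Fin n) (t : ℕ), (∀ s, t ≤ s → e s ≠ .crash p) →
      (∀ m, ∃ s, m ≤ s ∧ e s = .step p) →
      ∃ s, t ≤ s ∧
        ∃ v, alg.Outputs (alg.exec inp (alg.initConfig inp) ((List.range s).map e)) p v

/-- The algorithm satisfies agreement, validity and (recoverable) wait-freedom in all executions
with events in `E`. -/
def SolvesUnder (E : Set (Event n)) : Prop :=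
  alg.Agreement E ∧ alg.Validity E ∧ alg.WaitFree E

/-- The algorithm solves consensus: in the executions without crash events. A participant that
halts is one that takes only finitely many steps. -/
def SolvesConsensus : Prop := alg.SolvesUnder (Set.range Event.step)

/-- The algorithm solves recoverable consensus, with independent crashes. -/
def SolvesRC : Prop := alg.SolvesUnder Set.univ

end Algorithm

namespace ObjType

/-- Consensus among `n` participants, for every set of input values, can be solved with objects of
type `T` and registers. -/
def CanSolveConsensus (T : ObjType.{u}) (n : ℕ) : Prop :=
  ∀ V : Type u, ∃ alg : Algorithm T n V, alg.SolvesConsensus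

/-- Recoverable consensus among `n` participants, for every set of input values, can be solved with
objects of type `T` and registers. -/
def CanSolveRC (T : ObjType.{u}) (n : ℕ) : Prop :=
  ∀ V : Type u, ∃ alg : Algorithm T n V, alg.SolvesRC

/-- The consensus number of `T`: the maximum number of participants that can solve consensus, or
`⊤` if there is no maximum. -/
noncomputable def cons (T : ObjType.{u}) : ℕ∞ :=
  ⨆ n ∈ {n : ℕ | T.CanSolveConsensus n}, (n : ℕ∞)

/-- The (independent) recoverable consensus number of `T`. -/
noncomputable def rcons (T : ObjType.{u}) : ℕ∞ :=
  ⨆ n ∈ {n : ℕ | T.CanSolveRC n}, (n : ℕ∞)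

end ObjType

/-!
Suppose that the operations of two opposing participants can be the first ones of executions that
lead to the same state. In a discerning type, a third participant would then get the same response
and leave the same state behind in both cases, although different teams went first. Hence each
`n`-discerning type with `3 ≤ n` is `2`-recording.

If consensus can be solved, then there is a bivalent configuration all of whose successors are
univalent. There, all participants are about to access the same object, since otherwise two steps
that lead to different decisions commute, or one hides the other. Who took the first step must then
be visible to every participant in its response and the state of that object: the type is
discerning.

Conversely, from a `2`-recording readable type, two participants solve recoverable consensus. Each
announces its input, applies its operation only if it reads the initial state, and reads from the
object who went first. An execution can return to the initial state for at most one choice of the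
first operation; let it be that of participant `0`. Participant `1` then yields whenever it finds
the initial state and an announcement of participant `0`, so that its operation is not mistaken for
the first one after participant `0` has already won.
-/

namespace ObjType

variable {T : ObjType.{u}} {n : ℕ}

theorem recordSet_singleton_of_ne {q : T.State} {op : Fin 2 → T.Op} {i j : Fin 2} (hij : i ≠ j) :
    T.recordSet q op {i} = {T.next q (op i), T.next (T.next q (op i)) (op j)} := by
  refine Set.Subset.antisymm ?_ (Set.pair_subset ?_ ?_)
  · rintro _ ⟨l, hl, ⟨i', hi', hhead⟩, rfl⟩
    obtain rfl := Finset.mem_singleton.mp hi'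
    obtain ⟨t, rfl⟩ := List.head?_eq_some_iff.mp hhead
    obtain ⟨hit, ht⟩ := List.nodup_cons.mp hl
    have htj : ∀ k ∈ t, k = j := fun k hk => by
      have : k ≠ i' := ne_of_mem_of_not_mem hk hit
      omega
    match t with
    | [] => exact .inl rfl
    | [k] => exact .inr (by simp [nextList, htj k])
    | k :: k' :: t => simp [htj k, htj k'] at ht
  · exact ⟨[i], by simp, ⟨i, by simp⟩, rfl⟩
  · exact ⟨[i, j], by simpa using hij, ⟨i, by simp⟩, rfl⟩

theorem isTeams_two_iff {A B : Finset (Fin 2)} :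
    IsTeams A B ↔ A = {0} ∧ B = {1} ∨ A = {1} ∧ B = {0} := by
  simp only [IsTeams]
  revert A B
  decide

theorem recording_two_iff :
    T.Recording 2 ↔
      ∃ (q : T.State) (op : Fin 2 → T.Op),
        Disjoint (T.recordSet q op {0}) (T.recordSet q op {1}) := by
  constructor
  · rintro ⟨q, A, B, op, hAB, hdisj, -⟩
    refine ⟨q, op, ?_⟩
    rw [← Set.disjoint_iff_inter_eq_empty] at hdisj
    obtain ⟨rfl, rfl⟩ | ⟨rfl, rfl⟩ := isTeams_two_iff.mp hAB
    exacts [hdisj, hdisj.symm]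
  · rintro ⟨q, op, hdisj⟩
    exact ⟨q, {0}, {1}, op, isTeams_two_iff.mpr (.inl ⟨rfl, rfl⟩), hdisj.inter_eq, .inr rfl,
      .inr rfl⟩

theorem mem_discernSet_of_notMem {q : T.State} {op : Fin n → T.Op} {X : Finset (Fin n)}
    {l : List (Fin n)} {i j : Fin n} (hl : (i :: l).Nodup) (hi : i ∈ X) (hj : j ∉ i :: l) :
    (T.resp (T.nextList op q (i :: l)) (op j), T.next (T.nextList op q (i :: l)) (op j)) ∈
      T.discernSet q op X j :=
  ⟨i :: l, [], by simpa using hl.concat hj, ⟨i, hi, rfl⟩, rfl, by simp [nextList]⟩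

/-- A state that two opposing operations can both reach first would, after the operation of a third
participant, become a response and a state that both teams can reach. -/
theorem Discerning.recording_two (h : T.Discerning n) (hn : 3 ≤ n) : T.Recording 2 := by
  obtain ⟨q, A, B, op, ⟨⟨a, ha⟩, ⟨b, hb⟩, hAB, -⟩, hdisj⟩ := h
  have hab : a ≠ b := Finset.disjoint_left.mp hAB ha |> ne_of_mem_of_not_mem hb |>.symm
  obtain ⟨c, hca, hcb⟩ := Fin.exists_ne_and_ne_of_two_lt a b hn
  have extend : ∀ {X i j}, i ∈ X → i ≠ j → c ≠ i → c ≠ j →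
      ∀ s ∈ ({T.next q (op i), T.next (T.next q (op i)) (op j)} : Set T.State),
        (T.resp s (op c), T.next s (op c)) ∈ T.discernSet q op X c := by
    rintro X i j hi hij hci hcj s (rfl | rfl)
    · exact mem_discernSet_of_notMem (l := []) (by simp) hi (by simpa)
    · exact mem_discernSet_of_notMem (l := [j]) (by simpa) hi (by simp [hci, hcj])
  refine recording_two_iff.mpr ⟨q, ![op a, op b], Set.disjoint_left.mpr fun s hsa hsb => ?_⟩
  rw [recordSet_singleton_of_ne zero_ne_one] at hsa
  rw [recordSet_singleton_of_ne one_ne_zero] at hsb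
  exact (Set.disjoint_iff_inter_eq_empty.mpr (hdisj c)).le_bot
    ⟨extend ha hab hca hcb s hsa, extend hb hab.symm hcb hca s hsb⟩

end ObjType

namespace Algorithm

variable {T : ObjType.{u}} {n : ℕ} {V : Type u} {alg : Algorithm T n V}

section Apply

variable {inp : Fin n → V} {c : alg.Config} {p : Fin n}

theorem apply_step_of_output {v : V} (h : alg.code p (c.loc p) = .output v) :
    alg.apply inp c (.step p) = c := by
  simp only [apply, h]

open Classical in
theorem apply_step_of_access {x : alg.Obj} {o : T.Op} {k : T.Resp → alg.Local}
    (h : alg.code p (c.loc p) = .access x o k) :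
    alg.apply inp c (.step p) =
      { c with
        obj := Function.update c.obj x (T.next (c.obj x) o)
        loc := Function.update c.loc p (k (T.resp (c.obj x) o)) } := by
  simp only [apply, h]

theorem apply_step_of_read {r : alg.Reg} {k : alg.RegVal → alg.Local}
    (h : alg.code p (c.loc p) = .read r k) :
    alg.apply inp c (.step p) = { c with loc := Function.update c.loc p (k (c.reg r)) } := by
  simp only [apply, h]

open Classical in
theorem apply_step_of_write {r : alg.Reg} {a : alg.RegVal} {k : alg.Local}
    (h : alg.code p (c.loc p) = .write r a k) :
    alg.apply inp c (.step p) =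
      { c with
        reg := Function.update c.reg r a
        loc := Function.update c.loc p k } := by
  simp only [apply, h]

theorem apply_crash :
    alg.apply inp c (.crash p) =
      { c with loc := Function.update c.loc p (alg.start p (inp p)) } := by
  simp only [apply]

theorem apply_step_loc_of_ne {q : Fin n} (h : q ≠ p) :
    (alg.apply inp c (.step p)).loc q = c.loc q := by
  cases hc : alg.code p (c.loc p) with
  | output v => rw [apply_step_of_output hc]
  | access x o k => simp only [apply_step_of_access hc, Function.update_of_ne h]
  | read r k => simp only [apply_step_of_read hc, Function.update_of_ne h]
  | write r a k => simp only [apply_step_of_write hc, Function.update_of_ne h]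

theorem code_apply_step_of_ne {q : Fin n} (h : q ≠ p) :
    alg.code q ((alg.apply inp c (.step p)).loc q) = alg.code q (c.loc q) := by
  rw [apply_step_loc_of_ne h]

theorem apply_loc_of_ne {e : Event n} (hs : e ≠ .step p) (hc : e ≠ .crash p) :
    (alg.apply inp c e).loc p = c.loc p := by
  cases e with
  | step q => exact apply_step_loc_of_ne fun h => hs (h ▸ rfl)
  | crash q => simp only [apply_crash, Function.update_of_ne fun h : p = q => hc (h ▸ rfl)]

end Apply

theorem exec_append (inp : Fin n → V) (c : alg.Config) (es es' : List (Event n)) :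
    alg.exec inp c (es ++ es') = alg.exec inp (alg.exec inp c es) es' :=
  List.foldl_append

theorem exec_range_succ (inp : Fin n → V) (c : alg.Config) (e : ℕ → Event n) (s : ℕ) :
    alg.exec inp c ((List.range (s + 1)).map e) =
      alg.apply inp (alg.exec inp c ((List.range s).map e)) (e s) := by
  rw [List.range_succ, List.map_append, exec_append]
  rfl

theorem exec_invariant {inp : Fin n → V} {P : alg.Config → Prop}
    (hP : ∀ c e, P c → P (alg.apply inp c e)) {c : alg.Config} (hc : P c) (es : List (Event n)) :
    P (alg.exec inp c es) :=
  List.foldlRecOn es _ hc fun c h e _ => hP c e h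

theorem SolvesUnder.mono {E E' : Set (Event n)} (h : alg.SolvesUnder E) (hE : E' ⊆ E) :
    alg.SolvesUnder E' :=
  ⟨fun inp es es' hes => h.1 inp es es' fun e he => hE (hes e he),
    fun inp es hes => h.2.1 inp es fun e he => hE (hes e he),
    fun inp e he => h.2.2 inp e fun s => hE (he s)⟩

section Run

/-- The configuration reached from `c` without crashes when the participants take steps in the
order of the list. -/
noncomputable def run (inp : Fin n → V) (c : alg.Config) (l : List (Fin n)) : alg.Config :=
  alg.exec inp c (l.map .step)

variable {inp inp' : Fin n → V} {c c' : alg.Config} {p q : Fin n}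

theorem run_cons (l : List (Fin n)) :
    run inp c (p :: l) = run inp (alg.apply inp c (.step p)) l := rfl

theorem run_append (l l' : List (Fin n)) : run inp c (l ++ l') = run inp (run inp c l) l' := by
  rw [run, List.map_append, exec_append]
  rfl

theorem run_congr_input (l : List (Fin n)) : run inp c l = run inp' c l := by
  induction l generalizing c with
  | nil => rfl
  | cons _ _ ih => exact ih

theorem run_loc_of_notMem {l : List (Fin n)} (h : p ∉ l) : (run inp c l).loc p = c.loc p := by
  induction l generalizing c with
  | nil => rfl
  | cons q l ih =>
    obtain ⟨hpq, hpl⟩ := not_or.mp (mt List.mem_cons.mpr h)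
    rw [run_cons, ih hpl, apply_step_loc_of_ne hpq]

/-- Participant `p` cannot distinguish the two configurations. -/
def Indist (p : Fin n) (c c' : alg.Config) : Prop :=
  c.obj = c'.obj ∧ c.reg = c'.reg ∧ c.loc p = c'.loc p

theorem Indist.refl (p : Fin n) (c : alg.Config) : Indist p c c := ⟨rfl, rfl, rfl⟩

theorem Indist.symm (h : Indist p c c') : Indist p c' c := ⟨h.1.symm, h.2.1.symm, h.2.2.symm⟩

theorem Indist.apply_step (h : Indist p c c') (inp : Fin n → V) :
    Indist p (alg.apply inp c (.step p)) (alg.apply inp c' (.step p)) := by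
  obtain ⟨ho, hr, hl⟩ := h
  cases hc : alg.code p (c.loc p) with
  | output v => rw [apply_step_of_output hc, apply_step_of_output (hl ▸ hc)]; exact ⟨ho, hr, hl⟩
  | access x o k =>
    rw [apply_step_of_access hc, apply_step_of_access (hl ▸ hc)]; simp [Indist, ho, hr]
  | read r k => rw [apply_step_of_read hc, apply_step_of_read (hl ▸ hc)]; simp [Indist, ho, hr]
  | write r a k => rw [apply_step_of_write hc, apply_step_of_write (hl ▸ hc)]; simp [Indist, ho, hr]

theorem Indist.run_replicate (h : Indist p c c') (inp : Fin n → V) (m : ℕ) :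
    Indist p (run inp c (List.replicate m p)) (run inp c' (List.replicate m p)) := by
  induction m generalizing c c' with
  | zero => exact h
  | succ _ ih => exact ih (h.apply_step inp)

end Run

section PendingSteps

variable {inp : Fin n → V} {c : alg.Config} {p q : Fin n}

/-- The next step of `p` is an access to the object `x`. -/
def Accesses (c : alg.Config) (p : Fin n) (x : alg.Obj) : Prop :=
  ∃ o k, alg.code p (c.loc p) = .access x o k

theorem Accesses.unique {x y : alg.Obj} (hx : Accesses c p x) (hy : Accesses c p y) : x = y := by
  obtain ⟨o, k, hx⟩ := hx
  obtain ⟨o', k', hy⟩ := hy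
  exact (Instr.access.inj (hx.symm.trans hy)).1

theorem indist_apply_step_of_read {r : alg.Reg} {k : alg.RegVal → alg.Local} (hqp : q ≠ p)
    (hp : alg.code p (c.loc p) = .read r k) : Indist q (alg.apply inp c (.step p)) c := by
  rw [apply_step_of_read hp]
  exact ⟨rfl, rfl, Function.update_of_ne hqp _ _⟩

theorem indist_run_of_write_write {r : alg.Reg} {a a' : alg.RegVal} {k k' : alg.Local}
    (hqp : q ≠ p) (hp : alg.code p (c.loc p) = .write r a k)
    (hq : alg.code q (c.loc q) = .write r a' k') :
    Indist q (run inp c [p, q]) (run inp c [q]) := by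
  have hq' := (code_apply_step_of_ne (inp := inp) hqp).trans hq
  simp only [run_cons, apply_step_of_write hq', apply_step_of_write hq]
  simp [run, exec, Indist, apply_step_of_write hp]

theorem run_comm_of_write_write {r r' : alg.Reg} {a a' : alg.RegVal} {k k' : alg.Local}
    (hqp : q ≠ p) (hr : r ≠ r') (hp : alg.code p (c.loc p) = .write r a k)
    (hq : alg.code q (c.loc q) = .write r' a' k') :
    run inp c [p, q] = run inp c [q, p] := by
  classical
  have hq' := (code_apply_step_of_ne (inp := inp) hqp).trans hq
  have hp' := (code_apply_step_of_ne (inp := inp) hqp.symm).trans hp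
  simp only [run_cons, apply_step_of_write hq', apply_step_of_write hp']
  simp only [apply_step_of_write hp, apply_step_of_write hq, Function.update_comm hqp,
    Function.update_comm hr]

theorem run_comm_of_write_access {r : alg.Reg} {a : alg.RegVal} {k : alg.Local} {x : alg.Obj}
    {o : T.Op} {k' : T.Resp → alg.Local} (hqp : q ≠ p)
    (hp : alg.code p (c.loc p) = .write r a k) (hq : alg.code q (c.loc q) = .access x o k') :
    run inp c [p, q] = run inp c [q, p] := by
  have hq' := (code_apply_step_of_ne (inp := inp) hqp).trans hq
  have hp' := (code_apply_step_of_ne (inp := inp) hqp.symm).trans hp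
  simp only [run_cons, apply_step_of_access hq', apply_step_of_write hp']
  simp only [apply_step_of_write hp, apply_step_of_access hq, Function.update_comm hqp]

theorem run_comm_of_access_access {x y : alg.Obj} {o o' : T.Op} {k k' : T.Resp → alg.Local}
    (hqp : q ≠ p) (hxy : x ≠ y) (hp : alg.code p (c.loc p) = .access x o k)
    (hq : alg.code q (c.loc q) = .access y o' k') :
    run inp c [p, q] = run inp c [q, p] := by
  classical
  have hq' := (code_apply_step_of_ne (inp := inp) hqp).trans hq
  have hp' := (code_apply_step_of_ne (inp := inp) hqp.symm).trans hp
  simp only [run_cons, apply_step_of_access hq', apply_step_of_access hp']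
  simp only [apply_step_of_access hp, apply_step_of_access hq, Function.update_comm hqp,
    Function.update_comm hxy, Function.update_of_ne hxy, Function.update_of_ne hxy.symm]

/-- A read goes unnoticed by the other participant, a write can be overwritten, and all other pairs
of steps commute, unless they access the same object. -/
theorem exists_accesses_or_exists_indist (hqp : q ≠ p) (hp : ∀ v, ¬ alg.Outputs c p v)
    (hq : ∀ v, ¬ alg.Outputs c q v) :
    (∃ x, Accesses c p x ∧ Accesses c q x) ∨
      ∃ l l' z, Indist z (run inp c (p :: l)) (run inp c (q :: l')) := by
  have of_comm (h : run inp c [p, q] = run inp c [q, p]) :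
      ∃ l l' z, Indist z (run inp c (p :: l)) (run inp c (q :: l')) :=
    ⟨[q], [p], p, h ▸ .refl _ _⟩
  cases hcp : alg.code p (c.loc p) with
  | output v => exact absurd hcp (hp v)
  | read r k => exact .inr ⟨[q], [], q, (indist_apply_step_of_read hqp hcp).apply_step inp⟩
  | write r a k =>
    cases hcq : alg.code q (c.loc q) with
    | output v => exact absurd hcq (hq v)
    | read r' k' =>
      exact .inr ⟨[], [p], p, (indist_apply_step_of_read hqp.symm hcq).symm.apply_step inp⟩
    | write r' a' k' =>
      by_cases hr : r = r'
      · subst hr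
        exact .inr ⟨[q], [], q, indist_run_of_write_write hqp hcp hcq⟩
      · exact .inr (of_comm (run_comm_of_write_write hqp hr hcp hcq))
    | access y o' k' => exact .inr (of_comm (run_comm_of_write_access hqp hcp hcq))
  | access x o k =>
    cases hcq : alg.code q (c.loc q) with
    | output v => exact absurd hcq (hq v)
    | read r' k' =>
      exact .inr ⟨[], [p], p, (indist_apply_step_of_read hqp.symm hcq).symm.apply_step inp⟩
    | write r' a' k' =>
      exact .inr (of_comm (run_comm_of_write_access hqp.symm hcq hcp).symm)
    | access y o' k' =>
      by_cases hxy : x = y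
      · subst hxy
        exact .inl ⟨x, ⟨o, k, hcp⟩, ⟨o', k', hcq⟩⟩
      · exact .inr (of_comm (run_comm_of_access_access hqp hxy hcp hcq))

end PendingSteps

section Valence

variable {inp : Fin n → V} {c : alg.Config}

/-- The configurations that arise in executions without crashes. -/
def Reachable (inp : Fin n → V) (c : alg.Config) : Prop :=
  ∃ l, c = run inp (alg.initConfig inp) l

theorem Reachable.run (h : Reachable inp c) (l : List (Fin n)) : Reachable inp (run inp c l) := by
  obtain ⟨l', rfl⟩ := h
  exact ⟨l' ++ l, (run_append l' l).symm⟩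

/-- The values that can still be output from `c` on, in executions without crashes. -/
def valence (inp : Fin n → V) (c : alg.Config) : Set V :=
  {v | ∃ l p, alg.Outputs (Algorithm.run inp c l) p v}

theorem valence_run_subset (l : List (Fin n)) :
    valence inp (Algorithm.run inp c l) ⊆ valence inp c := by
  rintro v ⟨l', p, h⟩
  exact ⟨l ++ l', p, by rwa [run_append]⟩

/-- A reachable configuration in which the decision is still open. -/
def Bivalent (inp : Fin n → V) (c : alg.Config) : Prop :=
  Reachable inp c ∧ (valence inp c).Nontrivial

/-- A bivalent configuration in which the next step, whoever takes it, settles the decision. -/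
def Critical (inp : Fin n → V) (c : alg.Config) : Prop :=
  Bivalent inp c ∧ ∀ p, ¬ Bivalent inp (alg.apply inp c (.step p))

theorem Critical.valence_subsingleton (hc : Critical inp c) (p : Fin n) :
    (valence inp (alg.apply inp c (.step p))).Subsingleton :=
  Set.not_nontrivial_iff.mp fun h => hc.2 p ⟨hc.1.1.run [p], h⟩

theorem forall_mem_map_step (l : List (Fin n)) :
    ∀ e ∈ l.map Event.step, e ∈ Set.range Event.step :=
  List.forall_mem_map.mpr fun i _ => ⟨i, rfl⟩

namespace SolvesConsensus

theorem eq_of_mem_valence (hs : alg.SolvesConsensus) (hc : Reachable inp c) {p : Fin n} {v w : V}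
    (hv : alg.Outputs c p v) (hw : w ∈ valence inp c) : v = w := by
  obtain ⟨l, rfl⟩ := hc
  obtain ⟨l', q, hq⟩ := hw
  refine hs.1 inp (l.map .step) (l'.map .step) ?_ p q v w hv (by rwa [exec_append])
  rw [← List.map_append]
  exact forall_mem_map_step _

theorem exists_input_eq (hs : alg.SolvesConsensus) {v : V}
    (hv : v ∈ valence inp (alg.initConfig inp)) : ∃ p, inp p = v := by
  obtain ⟨l, q, hq⟩ := hv
  exact hs.2.1 inp (l.map .step) (forall_mem_map_step l) q v hq

theorem exists_outputs_run_replicate (hs : alg.SolvesConsensus) (hc : Reachable inp c)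
    (p : Fin n) : ∃ m v, alg.Outputs (run inp c (List.replicate m p)) p v := by
  obtain ⟨l, rfl⟩ := hc
  obtain ⟨s, hls, v, hv⟩ := hs.2.2 inp (fun s => .step (l.getD s p)) (fun s => ⟨_, rfl⟩) p l.length
    (fun s _ => by simp) (fun m => ⟨max m l.length, le_max_left _ _, by simp⟩)
  have hsched : (List.range s).map (fun s => Event.step (l.getD s p)) =
      (l ++ List.replicate (s - l.length) p).map Event.step := by
    apply List.ext_getElem
    · simp; lia
    · intro i _ _
      rcases lt_or_ge i l.length with hi | hi <;> simp [hi]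
  refine ⟨s - l.length, v, ?_⟩
  rw [← run_append, run, ← hsched]
  exact hv

theorem exists_mem_valence_of_indist (hs : alg.SolvesConsensus) (hc : Reachable inp c)
    {inp' : Fin n → V} {c' : alg.Config} {p : Fin n} (h : Indist p c c') :
    ∃ v ∈ valence inp c, v ∈ valence inp' c' := by
  obtain ⟨m, v, hv⟩ := hs.exists_outputs_run_replicate hc p
  refine ⟨v, ⟨_, p, hv⟩, List.replicate m p, p, ?_⟩
  rw [Outputs, run_congr_input (inp' := inp), ← (h.run_replicate inp m).2.2]
  exact hv

theorem not_outputs_of_bivalent (hs : alg.SolvesConsensus) (hc : Bivalent inp c) (p : Fin n)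
    (v : V) : ¬ alg.Outputs c p v := fun hv =>
  hc.2.not_subsingleton fun _ hx _ hy =>
    (hs.eq_of_mem_valence hc.1 hv hx).symm.trans (hs.eq_of_mem_valence hc.1 hv hy)

/-- Running alone, `p` cannot tell whether all participants have its input, in which case it has to
output that input. -/
theorem input_mem_valence (hs : alg.SolvesConsensus) (inp : Fin n → V) (p : Fin n) :
    inp p ∈ valence inp (alg.initConfig inp) := by
  obtain ⟨v, hv, hv'⟩ := hs.exists_mem_valence_of_indist (p := p) ⟨[], rfl⟩
    (show Indist p (alg.initConfig inp) (alg.initConfig fun _ => inp p) from ⟨rfl, rfl, rfl⟩)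
  obtain ⟨_, rfl⟩ := hs.exists_input_eq hv'
  exact hv

theorem exists_bivalent_init [Nontrivial V] (hs : alg.SolvesConsensus) (hn : 2 ≤ n) :
    ∃ inp, Bivalent inp (alg.initConfig inp) := by
  have : Nontrivial (Fin n) := Fin.nontrivial_iff_two_le.mpr hn
  obtain ⟨p, q, hpq⟩ := exists_pair_ne (Fin n)
  obtain ⟨v, w, hvw⟩ := exists_pair_ne V
  let inp : Fin n → V := fun i => if i = p then v else w
  refine ⟨inp, ⟨[], rfl⟩, inp p, hs.input_mem_valence inp p, inp q, hs.input_mem_valence inp q, ?_⟩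
  simpa [inp, hpq.symm] using hvw

/-- Otherwise some participant could take a step to a bivalent configuration again and again, but
nothing is output in an execution through bivalent configurations. -/
theorem exists_critical [Nontrivial V] (hs : alg.SolvesConsensus) (hn : 2 ≤ n) :
    ∃ inp, ∃ c : alg.Config, Critical inp c := by
  obtain ⟨inp, h₀⟩ := hs.exists_bivalent_init hn
  by_contra! hcrit
  have hnext : ∀ c, Bivalent inp c → ∃ p, Bivalent inp (alg.apply inp c (.step p)) := by
    simpa [Critical] using hcrit inp
  have : Nonempty (Fin n) := ⟨⟨0, by lia⟩⟩
  choose! f hf using hnext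
  let orbit : ℕ → alg.Config := fun s =>
    (fun c => alg.apply inp c (.step (f c)))^[s] (alg.initConfig inp)
  let e : ℕ → Event n := fun s => .step (f (orbit s))
  have horbit : ∀ s, Bivalent inp (orbit s) := Function.Iterate.rec (Bivalent inp) h₀ hf
  have hexec (s : ℕ) : alg.exec inp (alg.initConfig inp) ((List.range s).map e) = orbit s := by
    induction s with
    | zero => rfl
    | succ s ih => simp only [exec_range_succ, ih, orbit, e, Function.iterate_succ_apply']
  obtain ⟨p, hp⟩ := Finite.exists_infinite_fiber fun s => f (orbit s)
  have hinf : ∀ m, ∃ s, m ≤ s ∧ e s = .step p := fun m =>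
    let ⟨s, hs, hms⟩ := (Set.infinite_coe_iff.mp hp).exists_gt m
    ⟨s, hms.le, congrArg Event.step hs⟩
  obtain ⟨s, -, v, hv⟩ := hs.2.2 inp e (fun s => ⟨_, rfl⟩) p 0 (by simp [e]) hinf
  exact hs.not_outputs_of_bivalent (horbit s) p v (hexec s ▸ hv)

theorem not_indist_of_disjoint_valence (hs : alg.SolvesConsensus) {c₁ c₂ : alg.Config}
    (hc : Reachable inp c₁) (hdisj : Disjoint (valence inp c₁) (valence inp c₂))
    (l l' : List (Fin n)) (z : Fin n) : ¬ Indist z (run inp c₁ l) (run inp c₂ l') := fun h =>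
  let ⟨_, hv, hv'⟩ := hs.exists_mem_valence_of_indist (hc.run l) h
  Set.disjoint_left.mp hdisj (valence_run_subset l hv) (valence_run_subset l' hv')

theorem exists_accesses_of_disjoint_valence (hs : alg.SolvesConsensus) (hc : Bivalent inp c)
    {p q : Fin n} (hdisj : Disjoint (valence inp (alg.apply inp c (.step p)))
      (valence inp (alg.apply inp c (.step q)))) :
    ∃ x, Accesses c p x ∧ Accesses c q x := by
  have hsep := hs.not_indist_of_disjoint_valence (hc.1.run [p]) hdisj
  have hqp : q ≠ p := by
    rintro rfl
    exact hsep [] [] q (.refl _ _)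
  refine (exists_accesses_or_exists_indist (inp := inp) hqp (hs.not_outputs_of_bivalent hc p)
    (hs.not_outputs_of_bivalent hc q)).resolve_right ?_
  rintro ⟨l, l', z, h⟩
  exact hsep l l' z h

end SolvesConsensus

end Valence

section Discerning

open Classical in
theorem run_obj_reg_of_forall_accesses {inp : Fin n → V} {c : alg.Config} {x : alg.Obj}
    {op : Fin n → T.Op} {k : Fin n → T.Resp → alg.Local} {l : List (Fin n)} (hl : l.Nodup)
    (hc : ∀ i ∈ l, alg.code i (c.loc i) = .access x (op i) (k i)) :
    (run inp c l).obj = Function.update c.obj x (T.nextList op (c.obj x) l) ∧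
      (run inp c l).reg = c.reg := by
  induction l generalizing c with
  | nil => exact ⟨(Function.update_eq_self x c.obj).symm, rfl⟩
  | cons j l ih =>
    obtain ⟨hj, hl⟩ := List.nodup_cons.mp hl
    have hstep := apply_step_of_access (inp := inp) (hc j List.mem_cons_self)
    obtain ⟨hobj, hreg⟩ := ih (c := alg.apply inp c (.step j)) hl fun i hi => by
      rw [code_apply_step_of_ne (ne_of_mem_of_not_mem hi hj)]
      exact hc i (List.mem_cons_of_mem j hi)
    rw [run_cons, hobj, hreg, hstep]
    simp [ObjType.nextList]

theorem run_loc_of_forall_accesses {inp : Fin n → V} {c : alg.Config} {x : alg.Obj}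
    {op : Fin n → T.Op} {k : Fin n → T.Resp → alg.Local} {l₁ l₂ : List (Fin n)} {j : Fin n}
    (hl : (l₁ ++ j :: l₂).Nodup)
    (hc : ∀ i, alg.code i (c.loc i) = .access x (op i) (k i)) :
    (run inp c (l₁ ++ j :: l₂)).loc j = k j (T.resp (T.nextList op (c.obj x) l₁) (op j)) := by
  obtain ⟨hj, hl⟩ := List.nodup_cons.mp (List.nodup_middle.mp hl)
  obtain ⟨hj₁, hj₂⟩ := not_or.mp (mt List.mem_append.mpr hj)
  have hcj : alg.code j ((run inp c l₁).loc j) = .access x (op j) (k j) := by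
    rw [run_loc_of_notMem hj₁, hc]
  rw [run_append, run_cons, run_loc_of_notMem hj₂, apply_step_of_access hcj,
    (run_obj_reg_of_forall_accesses (List.Nodup.of_append_left hl) fun i _ => hc i).1]
  simp

theorem discerning_of_forall_accesses {inp : Fin n → V} {c : alg.Config} {x : alg.Obj}
    {A B : Finset (Fin n)} (hAB : ObjType.IsTeams A B) (hx : ∀ p, Accesses c p x)
    (hsep : ∀ p ∈ A, ∀ q ∈ B, ∀ l l' z, ¬ Indist z (run inp c (p :: l)) (run inp c (q :: l'))) :
    T.Discerning n := by
  choose op k hc using hx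
  refine ⟨c.obj x, A, B, op, hAB, fun j => Set.eq_empty_iff_forall_notMem.mpr ?_⟩
  rintro ⟨r, s⟩ ⟨⟨l₁, l₂, hl, ⟨p, hp, hhead⟩, hr, hs⟩, ⟨l₁', l₂', hl', ⟨q, hq, hhead'⟩, hr', hs'⟩⟩
  obtain ⟨t, ht⟩ := List.head?_eq_some_iff.mp hhead
  obtain ⟨t', ht'⟩ := List.head?_eq_some_iff.mp hhead'
  refine hsep p hp q hq t t' j ?_
  obtain ⟨hobj, hreg⟩ := run_obj_reg_of_forall_accesses (inp := inp) hl fun i _ => hc i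
  obtain ⟨hobj', hreg'⟩ := run_obj_reg_of_forall_accesses (inp := inp) hl' fun i _ => hc i
  rw [← ht, ← ht']
  refine ⟨?_, hreg.trans hreg'.symm, ?_⟩
  · rw [hobj, hobj', ← hs, ← hs']
  · rw [run_loc_of_forall_accesses hl hc, run_loc_of_forall_accesses hl' hc, ← hr, ← hr']

theorem exists_forall_accesses {c : alg.Config} {A B : Finset (Fin n)}
    (hAB : ObjType.IsTeams A B)
    (h : ∀ p ∈ A, ∀ q ∈ B, ∃ x, Accesses c p x ∧ Accesses c q x) :
    ∃ x, ∀ p, Accesses c p x := by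
  obtain ⟨⟨p₀, hp₀⟩, ⟨q₀, hq₀⟩, -, hunion⟩ := hAB
  obtain ⟨x, hxp₀, hxq₀⟩ := h p₀ hp₀ q₀ hq₀
  refine ⟨x, fun p => ?_⟩
  rcases Finset.mem_union.mp (hunion ▸ Finset.mem_univ p) with hp | hp
  · obtain ⟨y, hyp, hyq₀⟩ := h p hp q₀ hq₀
    rwa [hxq₀.unique hyq₀]
  · obtain ⟨y, hyp₀, hyp⟩ := h p₀ hp₀ p hp
    rwa [hxp₀.unique hyp₀]

theorem SolvesConsensus.exists_teams_of_critical {inp : Fin n → V} {c : alg.Config}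
    (hs : alg.SolvesConsensus) (hc : Critical inp c) :
    ∃ A B : Finset (Fin n), ObjType.IsTeams A B ∧ ∀ p ∈ A, ∀ q ∈ B,
      Disjoint (valence inp (alg.apply inp c (.step p)))
        (valence inp (alg.apply inp c (.step q))) := by
  classical
  have hstep : ∀ v ∈ valence inp c, ∃ p, v ∈ valence inp (alg.apply inp c (.step p)) := by
    rintro v ⟨_ | ⟨p, l⟩, q, hq⟩
    exacts [absurd hq (hs.not_outputs_of_bivalent hc.1 q v), ⟨p, l, q, hq⟩]
  obtain ⟨v, hv, w, hw, hvw⟩ := hc.1.2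
  obtain ⟨p, hp⟩ := hstep v hv
  obtain ⟨q, hq⟩ := hstep w hw
  refine ⟨({p | v ∈ valence inp (alg.apply inp c (.step p))} : Finset (Fin n)),
    ({p | v ∉ valence inp (alg.apply inp c (.step p))} : Finset (Fin n)),
    ⟨⟨p, by simpa using hp⟩, ⟨q, ?_⟩, Finset.disjoint_filter_filter_not _ _ _,
      Finset.filter_union_filter_not_eq _ _⟩, ?_⟩
  · simpa using fun hv => hvw (hc.valence_subsingleton q hv hq)
  · simp only [Finset.mem_filter_univ]
    exact fun p hp q hq => Set.disjoint_left.mpr fun u hu hu' =>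
      hq (hc.valence_subsingleton p hu hp ▸ hu')

/-- In a critical configuration all participants are about to access the same object, and their
operations discern between the participants whose steps lead to different decisions. -/
theorem SolvesConsensus.discerning [Nontrivial V] (hs : alg.SolvesConsensus) (hn : 2 ≤ n) :
    T.Discerning n := by
  obtain ⟨inp, c, hc⟩ := hs.exists_critical hn
  obtain ⟨A, B, hAB, hdisj⟩ := hs.exists_teams_of_critical hc
  obtain ⟨x, hx⟩ := exists_forall_accesses hAB fun p hp q hq =>
    hs.exists_accesses_of_disjoint_valence hc.1 (hdisj p hp q hq)
  exact discerning_of_forall_accesses hAB hx fun p hp q hq =>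
    hs.not_indist_of_disjoint_valence (hc.1.1.run [p]) (hdisj p hp q hq)

end Discerning

section Invariants

/-- The rank bounds the number of steps until a run ends: consider a time from which on it does not
drop any more. -/
theorem waitFree_of_rank {α : Type*} [Preorder α] [WellFoundedLT α]
    (rank : Fin n → alg.Local → α)
    (hrank : ∀ inp c p, (∃ v, alg.Outputs c p v) ∨
      rank p ((alg.apply inp c (.step p)).loc p) < rank p (c.loc p))
    (E : Set (Event n)) : alg.WaitFree E := by
  intro inp e _ p t hcrash hstep
  by_contra! hout
  let cfg : ℕ → alg.Config := fun s => alg.exec inp (alg.initConfig inp) ((List.range s).map e)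
  let ρ : ℕ → α := fun s => rank p ((cfg s).loc p)
  have hcfg (s : ℕ) : cfg (s + 1) = alg.apply inp (cfg s) (e s) := exec_range_succ ..
  have hlt : ∀ s, t ≤ s → e s = .step p → ρ (s + 1) < ρ s := fun s hs he => by
    simp only [ρ, hcfg, he]
    exact (hrank inp (cfg s) p).resolve_left fun ⟨v, hv⟩ => hout s hs v hv
  have hle : ∀ s, t ≤ s → ρ (s + 1) ≤ ρ s := fun s hs => by
    by_cases he : e s = .step p
    · exact (hlt s hs he).le
    · simp only [ρ, hcfg, apply_loc_of_ne he (hcrash s hs), le_refl]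
  obtain ⟨s, hts, hmin⟩ :=
    (InvImage.wf ρ wellFounded_lt).has_min (Set.Ici t) ⟨t, Set.self_mem_Ici⟩
  have hanti : ∀ s', s ≤ s' → ρ s' ≤ ρ s := fun s' hs' => by
    induction s', hs' using Nat.le_induction with
    | base => exact le_rfl
    | succ s' hs' ih => exact (hle s' (hts.trans hs')).trans ih
  obtain ⟨s', hs', he⟩ := hstep s
  exact hmin (s' + 1) (hts.trans (hs'.trans s'.le_succ))
    ((hlt s' (hts.trans hs') he).trans_le (hanti s' hs'))

theorem agreement_and_validity_of_invariant {Undecided : (Fin n → V) → alg.Config → Prop}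
    {Decided : (Fin n → V) → Fin n → alg.Config → Prop}
    (hinit : ∀ inp, Undecided inp (alg.initConfig inp))
    (hundecided : ∀ inp c e, Undecided inp c →
      Undecided inp (alg.apply inp c e) ∨ ∃ w, Decided inp w (alg.apply inp c e))
    (hdecided : ∀ inp w c e, Decided inp w c → Decided inp w (alg.apply inp c e))
    (hnot : ∀ inp c, Undecided inp c → ∀ p v, ¬ alg.Outputs c p v)
    (heq : ∀ inp w c, Decided inp w c → ∀ p v, alg.Outputs c p v → v = inp w)
    (E : Set (Event n)) : alg.Agreement E ∧ alg.Validity E := by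
  have hinv (inp : Fin n → V) (es : List (Event n)) :
      Undecided inp (alg.exec inp (alg.initConfig inp) es) ∨
        ∃ w, Decided inp w (alg.exec inp (alg.initConfig inp) es) := by
    refine exec_invariant (P := fun c => Undecided inp c ∨ ∃ w, Decided inp w c) ?_
      (.inl (hinit inp)) es
    rintro c e (h | ⟨w, h⟩)
    exacts [hundecided inp c e h, .inr ⟨w, hdecided inp w c e h⟩]
  constructor
  · intro inp es es' _ p p' v v' hv hv'
    rcases hinv inp es with h | ⟨w, h⟩
    · exact absurd hv (hnot inp _ h p v)
    · rw [exec_append] at hv'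
      exact (heq inp w _ h p v hv).trans
        (heq inp w _ (exec_invariant (hdecided inp w) h es') p' v' hv').symm
  · intro inp es _ p v hv
    rcases hinv inp es with h | ⟨w, h⟩
    · exact absurd hv (hnot inp _ h p v)
    · exact ⟨w, (heq inp w _ h p v hv).symm⟩

end Invariants

end Algorithm

/-- The data from which two participants solve recoverable consensus: a state and two operations
that witness that `T` is `2`-recording, ordered such that the initial state cannot be reached by an
execution that starts with operation `1`, and a read operation, whose responses are decoded to the
states they stand for. -/
structure RecordingPair (T : ObjType.{u}) where
  init : T.State
  op : Fin 2 → T.Op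
  read : T.Op
  decode : T.Resp → T.State
  next_read : ∀ s, T.next s read = s
  decode_resp : ∀ s, decode (T.resp s read) = s
  disjoint : Disjoint (T.recordSet init op {0}) (T.recordSet init op {1})
  init_notMem : init ∉ T.recordSet init op {1}

namespace RecordingPair

open Algorithm

variable {T : ObjType.{u}}

theorem nonempty (h : T.Recording 2) (hT : T.Readable) : Nonempty (RecordingPair T) := by
  obtain ⟨q, op, hdisj⟩ := ObjType.recording_two_iff.mp h
  obtain ⟨read, hnext, hinj⟩ := hT
  have : Nonempty T.State := ⟨q⟩
  obtain ⟨decode, hdecode⟩ := hinj.hasLeftInverse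
  by_cases hq : q ∈ T.recordSet q op {1}
  · have hswap {i j : Fin 2} (hij : i ≠ j) :
        T.recordSet q (op ∘ Fin.rev) {i} = T.recordSet q op {j} := by
      obtain rfl : j = i.rev := by revert i j; decide
      rw [ObjType.recordSet_singleton_of_ne hij, ObjType.recordSet_singleton_of_ne hij.symm]
      simp
    refine ⟨⟨q, op ∘ Fin.rev, read, decode, hnext, hdecode, ?_, ?_⟩⟩
    · rw [hswap zero_ne_one, hswap one_ne_zero]
      exact hdisj.symm
    · rw [hswap one_ne_zero]
      exact Set.disjoint_right.mp hdisj hq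
  · exact ⟨⟨q, op, read, decode, hnext, hdecode, hdisj, hq⟩⟩

/-- What a participant is about to do in the protocol `RecordingPair.alg`. -/
inductive Phase where
  | announce
  | look
  | check
  | update
  | decide
  | adopt
  | done
  deriving DecidableEq

/-- A bound on the number of steps until the run ends. -/
def Phase.rank : Phase → ℕ
  | announce => 6
  | look => 5
  | check => 4
  | update => 3
  | decide => 2
  | adopt => 1
  | done => 0

variable (W : RecordingPair T) {V : Type u}

/-- The states that record that the operation of participant `p` was the first one. -/
def recorded (p : Fin 2) : Set T.State := T.recordSet W.init W.op {p}

open Classical in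
/-- How participant `p` with input `v` proceeds when it finds the object in a state `s` that
records whose operation was the first one. -/
noncomputable def settle (p : Fin 2) (v : V) (s : T.State) : Phase × V :=
  if s ∈ W.recorded p then (.done, v) else (.adopt, v)

open Classical in
/-- How participant `p` with input `v` proceeds when it finds the object in state `s` before its
own operation. The initial state can also be one that records that operation `0` was the first one.
Therefore participant `1` does not apply its operation if it finds an announcement of the other
participant afterwards. -/
noncomputable def look (p : Fin 2) (v : V) (s : T.State) : Phase × V :=
  if s = W.init then (if p = 0 then .update else .check, v) else W.settle p v s

/-- The protocol. The participants announce their inputs in registers, and the winner is the one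
whose operation is applied first, or participant `0` if participant `1` yields to it. The value in
a local state is the input until the phase is `done`, and then the output. -/
noncomputable abbrev alg (V : Type u) : Algorithm T 2 V where
  Obj := PUnit
  Reg := ULift (Fin 2)
  RegVal := Option V
  Local := Phase × V
  objInit _ := W.init
  regInit _ := none
  start _ v := (.announce, v)
  code p
    | (.announce, v) => .write ⟨p⟩ (some v) (.look, v)
    | (.look, v) => .access ⟨⟩ W.read fun r => W.look p v (W.decode r)
    | (.check, v) => .read ⟨0⟩ fun x => x.elim (.update, v) (.done, ·)
    | (.update, v) => .access ⟨⟩ (W.op p) fun _ => (.decide, v)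
    | (.decide, v) => .access ⟨⟩ W.read fun r => W.settle p v (W.decode r)
    | (.adopt, v) => .read ⟨p.rev⟩ fun x => (.done, x.getD v)
    | (.done, v) => .output v

variable {W} {inp : Fin 2 → V} {c : (W.alg V).Config} {p q : Fin 2}

/-- The state of the only object. -/
def state (c : (W.alg V).Config) : T.State := c.obj ⟨⟩

/-- The content of the register of a participant. -/
def announced (c : (W.alg V).Config) (p : Fin 2) : Option V := c.reg ⟨p⟩

/-- The phase of a participant. -/
def phase (c : (W.alg V).Config) (p : Fin 2) : Phase := (c.loc p).1

/-- The input or output in the local state of a participant. -/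
def value (c : (W.alg V).Config) (p : Fin 2) : V := (c.loc p).2

/-- The local state of `p` after its next step. -/
noncomputable def nextLoc (c : (W.alg V).Config) (p : Fin 2) : Phase × V :=
  match phase c p with
  | .announce => (.look, value c p)
  | .look => W.look p (value c p) (state c)
  | .check => (announced c 0).elim (.update, value c p) (.done, ·)
  | .update => (.decide, value c p)
  | .decide => W.settle p (value c p) (state c)
  | .adopt => (.done, (announced c p.rev).getD (value c p))
  | .done => (.done, value c p)

section Transitions

variable (inp c p)

theorem apply_step :
    (W.alg V).apply inp c (.step p) =
      { obj := fun _ => if phase c p = .update then T.next (state c) (W.op p) else state c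
        reg := fun i => if phase c p = .announce ∧ i = ⟨p⟩ then some (value c p) else c.reg i
        loc := Function.update c.loc p (nextLoc c p) } := by
  rcases hl : c.loc p with ⟨ph, v⟩
  have hcode := congrArg ((W.alg V).code p) hl
  cases ph with
  | announce =>
    rw [apply_step_of_write hcode]
    ext i : 2 <;> simp [nextLoc, phase, value, hl, state, Function.update_apply]
  | look =>
    rw [apply_step_of_access hcode]
    ext i : 2 <;> simp [nextLoc, phase, value, hl, state, W.next_read, W.decode_resp]
  | check =>
    rw [apply_step_of_read hcode]
    ext i : 2 <;> simp [nextLoc, phase, value, hl, state, announced]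
  | update =>
    rw [apply_step_of_access hcode]
    ext i : 2 <;> simp [nextLoc, phase, value, hl, state]
  | decide =>
    rw [apply_step_of_access hcode]
    ext i : 2 <;> simp [nextLoc, phase, value, hl, state, W.next_read, W.decode_resp]
  | adopt =>
    rw [apply_step_of_read hcode]
    ext i : 2 <;> simp [nextLoc, phase, value, hl, state, announced]
  | done =>
    rw [apply_step_of_output hcode]
    have hph : phase c p = .done := congrArg Prod.fst hl
    have hnext : nextLoc c p = c.loc p := by simp [nextLoc, phase, value, hl]
    ext i : 2 <;> simp [hph, hnext, state]

theorem outputs_iff {v : V} : (W.alg V).Outputs c p v ↔ phase c p = .done ∧ value c p = v := by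
  rcases hl : c.loc p with ⟨ph, w⟩
  cases ph <;> simp [Outputs, phase, value, hl]

theorem state_apply_step :
    state ((W.alg V).apply inp c (.step p)) =
      if phase c p = .update then T.next (state c) (W.op p) else state c := by
  simp [apply_step, state]

theorem announced_apply_step :
    announced ((W.alg V).apply inp c (.step p)) q =
      if phase c p = .announce ∧ q = p then some (value c p) else announced c q := by
  simp [apply_step, announced]

theorem phase_apply_step :
    phase ((W.alg V).apply inp c (.step p)) q =
      if q = p then (nextLoc c p).1 else phase c q := by
  simp only [apply_step, phase, Function.update_apply, apply_ite Prod.fst]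

theorem value_apply_step :
    value ((W.alg V).apply inp c (.step p)) q =
      if q = p then (nextLoc c p).2 else value c q := by
  simp only [apply_step, value, Function.update_apply, apply_ite Prod.snd]

theorem state_apply_crash : state ((W.alg V).apply inp c (.crash p)) = state c := by
  simp [apply_crash, state]

theorem announced_apply_crash :
    announced ((W.alg V).apply inp c (.crash p)) q = announced c q := by
  simp [apply_crash, announced]

theorem phase_apply_crash :
    phase ((W.alg V).apply inp c (.crash p)) q = if q = p then .announce else phase c q := by
  simp only [apply_crash, phase, Function.update_apply, apply_ite Prod.fst]

theorem value_apply_crash :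
    value ((W.alg V).apply inp c (.crash p)) q = if q = p then inp p else value c q := by
  simp only [apply_crash, value, Function.update_apply, apply_ite Prod.snd]

end Transitions

theorem rank_nextLoc_lt (h : phase c p ≠ .done) : (nextLoc c p).1.rank < (phase c p).rank := by
  cases hp : phase c p with
  | done => contradiction
  | look => simp only [nextLoc, hp, look, settle]; split_ifs <;> simp [Phase.rank]
  | check => simp only [nextLoc, hp]; cases announced c 0 <;> simp [Phase.rank]
  | decide => simp only [nextLoc, hp, settle]; split_ifs <;> simp [Phase.rank]
  | _ => simp only [nextLoc, hp]; simp [Phase.rank]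

theorem waitFree (E : Set (Event 2)) : (W.alg V).WaitFree E := by
  refine waitFree_of_rank (fun _ (l : Phase × V) => l.1.rank) (fun inp c p => ?_) E
  by_cases h : phase c p = .done
  · exact .inl ⟨_, (outputs_iff c p).mpr ⟨h, rfl⟩⟩
  · simpa only [apply_step, Function.update_self] using .inr (rank_nextLoc_lt h)

section Invariants

/-- What holds throughout every execution. -/
structure Consistent (inp : Fin 2 → V) (c : (W.alg V).Config) : Prop where
  value_eq : ∀ p, phase c p ≠ .done → value c p = inp p
  announced_eq : ∀ p, announced c p = none ∨ announced c p = some (inp p)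
  announced_ne : ∀ p, phase c p ≠ .announce → announced c p = some (inp p)
  phase_zero : phase c 0 ≠ .check

/-- The configurations in which both participants can still win: the object is in its initial state,
and participant `1` does not yet have to yield to participant `0`. -/
structure Undecided (inp : Fin 2 → V) (c : (W.alg V).Config) : Prop extends Consistent inp c where
  state_eq : state c = W.init
  phase_ne : ∀ p, phase c p ≠ .decide ∧ phase c p ≠ .adopt ∧ phase c p ≠ .done
  zero_or_one : announced c 0 = none ∨ phase c 1 = .update

/-- The configurations in which participant `0` has won. -/
structure DecidedZero (inp : Fin 2 → V) (c : (W.alg V).Config) : Prop extends Consistent inp c where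
  announced_winner : announced c 0 = some (inp 0)
  state_eq : state c = T.next W.init (W.op 0) ∨ phase c 1 ≠ .update ∧
    (state c = W.init ∨ state c = T.next (T.next W.init (W.op 0)) (W.op 1))
  state_of_update : phase c 0 = .update → state c = W.init
  state_of_decide : phase c 0 = .decide → state c ∈ W.recorded 0
  phase_winner : phase c 0 ≠ .adopt
  value_of_done : ∀ p, phase c p = .done → value c p = inp 0

/-- The configurations in which participant `1` has won. -/
structure DecidedOne (inp : Fin 2 → V) (c : (W.alg V).Config) : Prop extends Consistent inp c where
  announced_winner : announced c 1 = some (inp 1)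
  state_mem : state c ∈ W.recorded 1
  state_of_update : phase c 0 = .update → state c = T.next W.init (W.op 1)
  phase_winner : phase c 1 ≠ .check ∧ phase c 1 ≠ .update ∧ phase c 1 ≠ .adopt
  value_of_done : ∀ p, phase c p = .done → value c p = inp 1

theorem mem_recorded_zero {s : T.State} :
    s ∈ W.recorded 0 ↔
      s = T.next W.init (W.op 0) ∨ s = T.next (T.next W.init (W.op 0)) (W.op 1) := by
  rw [recorded, ObjType.recordSet_singleton_of_ne zero_ne_one]
  rfl

theorem mem_recorded_one {s : T.State} :
    s ∈ W.recorded 1 ↔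
      s = T.next W.init (W.op 1) ∨ s = T.next (T.next W.init (W.op 1)) (W.op 0) := by
  rw [recorded, ObjType.recordSet_singleton_of_ne one_ne_zero]
  rfl

theorem notMem_recorded_one {s : T.State} (h : s ∈ W.recorded 0) : s ∉ W.recorded 1 :=
  Set.disjoint_left.mp W.disjoint h

theorem init_notMem_recorded_one : W.init ∉ W.recorded 1 := W.init_notMem

theorem next_zero_ne_init : T.next W.init (W.op 0) ≠ W.init := fun h =>
  notMem_recorded_one (mem_recorded_zero.mpr (.inr rfl)) (mem_recorded_one.mpr (.inl (by rw [h])))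

theorem Consistent.crash (h : Consistent inp c) (p : Fin 2) :
    Consistent inp ((W.alg V).apply inp c (.crash p)) := by
  obtain ⟨hvalue, hannounced, hannounced', hphase⟩ := h
  constructor <;> grind [announced_apply_crash, phase_apply_crash, value_apply_crash]

theorem Consistent.step (h : Consistent inp c) (p : Fin 2) :
    Consistent inp ((W.alg V).apply inp c (.step p)) := by
  obtain ⟨hvalue, hannounced, hannounced', hphase⟩ := h
  constructor
  · grind [phase_apply_step, value_apply_step, nextLoc, look, settle]
  · grind [announced_apply_step]
  · grind [announced_apply_step, phase_apply_step]
  · grind [phase_apply_step, nextLoc, look, settle]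

theorem DecidedZero.crash (h : DecidedZero inp c) (p : Fin 2) :
    DecidedZero inp ((W.alg V).apply inp c (.crash p)) where
  toConsistent := h.toConsistent.crash p
  announced_winner := by grind [announced_apply_crash, DecidedZero]
  state_eq := by grind [state_apply_crash, phase_apply_crash, DecidedZero]
  state_of_update := by grind [state_apply_crash, phase_apply_crash, DecidedZero]
  state_of_decide := by grind [state_apply_crash, phase_apply_crash, DecidedZero]
  phase_winner := by grind [phase_apply_crash, DecidedZero]
  value_of_done := by grind [phase_apply_crash, value_apply_crash, DecidedZero]

theorem DecidedOne.crash (h : DecidedOne inp c) (p : Fin 2) :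
    DecidedOne inp ((W.alg V).apply inp c (.crash p)) where
  toConsistent := h.toConsistent.crash p
  announced_winner := by grind [announced_apply_crash, DecidedOne]
  state_mem := by grind [state_apply_crash, DecidedOne]
  state_of_update := by grind [state_apply_crash, phase_apply_crash, DecidedOne]
  phase_winner := by grind [phase_apply_crash, DecidedOne]
  value_of_done := by grind [phase_apply_crash, value_apply_crash, DecidedOne]

theorem DecidedZero.step (h : DecidedZero inp c) (p : Fin 2) :
    DecidedZero inp ((W.alg V).apply inp c (.step p)) where
  toConsistent := h.toConsistent.step p
  announced_winner := by grind [announced_apply_step, DecidedZero, Consistent]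
  state_eq := by
    grind [state_apply_step, phase_apply_step, DecidedZero, Consistent, nextLoc, look, settle,
      next_zero_ne_init]
  state_of_update := by
    grind [state_apply_step, phase_apply_step, DecidedZero, Consistent, nextLoc, look, settle,
      next_zero_ne_init]
  state_of_decide := by
    grind [state_apply_step, phase_apply_step, DecidedZero, Consistent, nextLoc, look, settle,
      mem_recorded_zero]
  phase_winner := by
    grind [phase_apply_step, DecidedZero, Consistent, nextLoc, look, settle, mem_recorded_zero]
  value_of_done := by
    grind [phase_apply_step, value_apply_step, DecidedZero, Consistent, nextLoc, look, settle,
      mem_recorded_zero, notMem_recorded_one, init_notMem_recorded_one]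

theorem DecidedOne.step (h : DecidedOne inp c) (p : Fin 2) :
    DecidedOne inp ((W.alg V).apply inp c (.step p)) where
  toConsistent := h.toConsistent.step p
  announced_winner := by grind [announced_apply_step, DecidedOne, Consistent]
  state_mem := by
    have hp : p = 0 ∨ p = 1 := by omega
    grind [state_apply_step, DecidedOne, mem_recorded_one]
  state_of_update := by
    grind [state_apply_step, phase_apply_step, DecidedOne, Consistent, nextLoc, look, settle,
      init_notMem_recorded_one]
  phase_winner := by
    grind [phase_apply_step, DecidedOne, Consistent, nextLoc, look, settle,
      init_notMem_recorded_one]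
  value_of_done := by
    grind [phase_apply_step, value_apply_step, DecidedOne, Consistent, nextLoc, look, settle,
      notMem_recorded_one, init_notMem_recorded_one]

theorem undecided_init (inp : Fin 2 → V) : Undecided inp ((W.alg V).initConfig inp) where
  value_eq _ _ := rfl
  announced_eq _ := .inl rfl
  announced_ne _ h := absurd rfl h
  phase_zero := Phase.noConfusion
  state_eq := rfl
  phase_ne _ := by simp [phase, initConfig]
  zero_or_one := .inl rfl

/-- The configurations in which participant `w` has won. -/
def Decided (inp : Fin 2 → V) (w : Fin 2) (c : (W.alg V).Config) : Prop :=
  if w = 0 then DecidedZero inp c else DecidedOne inp c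

theorem Decided.apply {w : Fin 2} (h : Decided inp w c) (e : Event 2) :
    Decided inp w ((W.alg V).apply inp c e) := by
  unfold Decided at *
  split_ifs at *
  · cases e with
    | step p => exact h.step p
    | crash p => exact h.crash p
  · cases e with
    | step p => exact h.step p
    | crash p => exact h.crash p

theorem Decided.eq_of_outputs {w : Fin 2} (h : Decided inp w c) {v : V}
    (hv : (W.alg V).Outputs c p v) : v = inp w := by
  rw [outputs_iff] at hv
  unfold Decided at h
  grind [DecidedZero, DecidedOne]

theorem Undecided.not_outputs (h : Undecided inp c) (v : V) : ¬ (W.alg V).Outputs c p v :=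
  fun hv => (h.phase_ne p).2.2 ((outputs_iff c p).mp hv).1

/-- A crash makes participant `1` lose if it had passed its check before participant `0` made its
announcement: its next run will yield. -/
theorem Undecided.crash (h : Undecided inp c) (p : Fin 2) :
    Undecided inp ((W.alg V).apply inp c (.crash p)) ∨
      DecidedZero inp ((W.alg V).apply inp c (.crash p)) := by
  by_cases hopen : announced c 0 = none ∨ p = 0 ∧ phase c 1 = .update
  · refine .inl ⟨h.toConsistent.crash p, ?_, ?_, ?_⟩
    · grind [state_apply_crash, Undecided]
    · grind [phase_apply_crash, Undecided]
    · grind [announced_apply_crash, phase_apply_crash]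
  · refine .inr ⟨h.toConsistent.crash p, ?_, ?_, ?_, ?_, ?_, ?_⟩
    · grind [announced_apply_crash, Undecided, Consistent]
    · grind [phase_apply_crash, state_apply_crash, Undecided]
    · grind [phase_apply_crash, state_apply_crash, Undecided]
    · grind [phase_apply_crash, state_apply_crash, Undecided]
    · grind [phase_apply_crash, Undecided]
    · grind [phase_apply_crash, Undecided]

theorem Undecided.step (h : Undecided inp c) (p : Fin 2) :
    Undecided inp ((W.alg V).apply inp c (.step p)) ∨
      DecidedZero inp ((W.alg V).apply inp c (.step p)) ∨
        DecidedOne inp ((W.alg V).apply inp c (.step p)) := by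
  have hp : p = 0 ∨ p = 1 := by omega
  by_cases hone : p = 1 ∧ phase c p = .update
  · refine .inr (.inr ⟨h.toConsistent.step p, ?_, ?_, ?_, ?_, ?_⟩)
    · grind [announced_apply_step, Undecided, Consistent]
    · grind [state_apply_step, Undecided, mem_recorded_one]
    · grind [state_apply_step, phase_apply_step, nextLoc, Undecided]
    · grind [phase_apply_step, nextLoc]
    · grind [phase_apply_step, nextLoc, Undecided]
  -- An announcement of participant `0` decides unless participant `1` has already passed its check.
  by_cases hzero : p = 0 ∧ (phase c p = .update ∨ phase c p = .announce ∧ phase c 1 ≠ .update)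
  · refine .inr (.inl ⟨h.toConsistent.step p, ?_, ?_, ?_, ?_, ?_, ?_⟩)
    · grind [announced_apply_step, Undecided, Consistent]
    · grind [state_apply_step, phase_apply_step, Undecided]
    · grind [state_apply_step, phase_apply_step, nextLoc, Undecided]
    · grind [state_apply_step, phase_apply_step, nextLoc, Undecided, mem_recorded_zero]
    · grind [phase_apply_step, nextLoc]
    · grind [phase_apply_step, nextLoc, Undecided]
  · refine .inl ⟨h.toConsistent.step p, ?_, ?_, ?_⟩
    · grind [state_apply_step, Undecided, Consistent]
    · grind [phase_apply_step, nextLoc, look, Undecided, Consistent]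
    · grind [announced_apply_step, phase_apply_step, nextLoc, Undecided, Consistent]

theorem Undecided.apply (h : Undecided inp c) (e : Event 2) :
    Undecided inp ((W.alg V).apply inp c e) ∨ ∃ w, Decided inp w ((W.alg V).apply inp c e) := by
  cases e with
  | step p =>
    rcases h.step p with h | h | h
    exacts [.inl h, .inr ⟨0, h⟩, .inr ⟨1, h⟩]
  | crash p => exact (h.crash p).imp_right fun h => ⟨0, h⟩

end Invariants

theorem solvesRC (W : RecordingPair T) (V : Type u) : (W.alg V).SolvesRC := by
  obtain ⟨hagree, hvalid⟩ := agreement_and_validity_of_invariant (alg := W.alg V)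
    (Undecided := Undecided) (Decided := Decided) undecided_init (fun _ _ e h => h.apply e)
    (fun _ _ _ e h => h.apply e) (fun _ _ h _ v => h.not_outputs v)
    (fun _ _ _ h _ _ hv => h.eq_of_outputs hv) Set.univ
  exact ⟨hagree, hvalid, waitFree _⟩

end RecordingPair

namespace ObjType

variable {T : ObjType.{u}} {n : ℕ}

theorem Recording.canSolveRC (h : T.Recording 2) (hT : T.Readable) : T.CanSolveRC 2 := fun V =>
  have ⟨W⟩ := RecordingPair.nonempty h hT
  ⟨W.alg V, W.solvesRC V⟩

theorem CanSolveRC.canSolveConsensus (h : T.CanSolveRC n) : T.CanSolveConsensus n := fun V =>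
  have ⟨alg, hs⟩ := h V
  ⟨alg, hs.mono (Set.subset_univ _)⟩

theorem CanSolveConsensus.discerning (h : T.CanSolveConsensus n) (hn : 2 ≤ n) : T.Discerning n :=
  have ⟨_, hs⟩ := h (ULift Bool)
  hs.discerning hn

theorem rcons_le_cons : T.rcons ≤ T.cons :=
  biSup_mono fun _ => CanSolveRC.canSolveConsensus

theorem CanSolveRC.le_rcons (h : T.CanSolveRC n) : n ≤ T.rcons :=
  le_biSup (fun m : ℕ => (m : ℕ∞)) h

theorem lt_cons_iff : n < T.cons ↔ ∃ m, n < m ∧ T.CanSolveConsensus m := by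
  simp only [cons, lt_iSup_iff, Set.mem_ofPred_eq, Nat.cast_lt, exists_prop, and_comm]

end ObjType

theorem proposition6_general (T : ObjType.{u}) :
    (∀ n, 3 ≤ n → T.Discerning n → T.Recording 2) ∧
      T.rcons ≤ T.cons ∧ (T.Readable → 3 ≤ T.cons → 2 ≤ T.rcons) := by
  refine ⟨fun _ hn h => h.recording_two hn, T.rcons_le_cons, fun hT h => ?_⟩
  have htwo : ((2 : ℕ) : ℕ∞) < T.cons := lt_of_lt_of_le (by norm_num) h
  obtain ⟨n, hn, hsolve⟩ := ObjType.lt_cons_iff.mp htwo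
  have hrecording : T.Recording 2 := (hsolve.discerning hn.le).recording_two hn
  exact (hrecording.canSolveRC hT).le_rcons

theorem proposition6 (T : ObjType.{u}) (hT : T.Readable) :
    (T.Discerning 3 → T.Recording 2) ∧
      (T.cons = 3 → 2 ≤ T.rcons ∧ T.rcons ≤ 3) := by
  obtain ⟨hrecording, hle, hge⟩ := proposition6_general T
  exact ⟨hrecording 3 le_rfl, fun h => ⟨hge hT h.ge, h ▸ hle⟩⟩
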